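/- Let $q$ be a prime power, $\mathbb F=\mathbb F_{q^2}$ and, for a finite abelian group $G$ of order $n$, let $\mathbb FG$ be the group algebra. A $2$-quasi-abelian code is an $\mathbb FG$-submodule $\mathcal C$ of $(\mathbb FG)^2$; it is regarded as a linear code of length $2n$ over $\mathbb F$, with rate $R(\mathcal C)=\dim_{\mathbb F}\mathcal C/(2n)$ and relative minimum distance $\Delta(\mathcal C)=\mathrm{wt}_H(\mathcal C)/(2n)$, where $\mathrm{wt}_H(\mathcal C)$ is the least Hamming weight of a nonzero word of $\mathcal C$. It is Hermitian LCD if $\mathcal C\cap\mathcal C^{\perp_H}=\{0\}$, where $\perp_H$ is taken with respect to the form $\langle(a,b),(a',b')\rangle_H=\sum_{g\in G}\bigl(a_g a_g'^{\,q}+b_g b_g'^{\,q}\bigr)$. A sequence of such codes is asymptotically good if the lengths tend to infinity and the rates and the relative minimum distances of all its members are bounded below by positive constants. When $\gcd(n,q)=1$, let $\mu_q(n)$ be the least value of $\dim_{\mathbb F}\mathbb FGe$ over the primitive idempotents $e\neq e_0=\frac1n\sum_{g\in G}g$ of $\mathbb FG$, and let $h_q(\delta)=\delta\log_q(q-1)-\delta\log_q\delta-(1-\delta)\log_q(1-\delta)$,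 where $0\log_q 0=0$. Theorem 3.17. Let $n_1,n_2,\dots$ be odd positive integers coprime to $q$ with $n_i\to\infty$, and let $G_i$ be an abelian group of order $n_i$ for each $i$, such that $\log_q n_i/\mu_q(n_i)\to 0$ (with $\mu_q(n_i)$ computed in $\mathbb FG_i$). Let $\delta$ be a real number with $0\le\delta\le 1-q^{-1}$ and $h_q(\delta)<\tfrac12$. Then there are Hermitian LCD $2$-quasi-abelian codes $\mathcal C_i\subseteq(\mathbb FG_i)^2$, $i=1,2,\dots$, of length $2n_i$ and rate $R(\mathcal C_i)=\tfrac12$, such that $\Delta(\mathcal C_i)>\delta$ for all sufficiently large $i$ and the sequence $\mathcal C_1,\mathcal C_2,\dots$ is asymptotically good. -/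

import Mathlib

open Filter Topology

namespace HermitianLCD

noncomputable section

/-- A 2-quasi-abelian code over `F`: an `FG`-submodule of `(FG)² = FG × FG`. -/
abbrev TwoQuasiAbelianCode (F G : Type*) [Field F] [CommGroup G] : Type _ :=
  Submodule (MonoidAlgebra F G) (MonoidAlgebra F G × MonoidAlgebra F G)

section Mu

variable (F G : Type*) [Field F] [CommGroup G] [Fintype G]

/-- The trivial idempotent `e₀ = |G|⁻¹ ∑ g` of `FG` (for `|G|` invertible in `F`). -/
def trivialIdempotent : MonoidAlgebra F G :=
  ((Fintype.card G : F)⁻¹) • ∑ g : G, MonoidAlgebra.single g (1 : F)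

/-- The quantity `μ`: the least `F`-dimension of an ideal `FG e`, where `e` runs through the
primitive idempotents of the group algebra `FG` other than `e₀`. -/
def mu : ℕ :=
  sInf {d : ℕ | ∃ e : MonoidAlgebra F G,
    -- `e` is a primitive idempotent
    (e ≠ 0 ∧ IsIdempotentElem e ∧
      ∀ f : MonoidAlgebra F G, IsIdempotentElem f → f * e = f → f = 0 ∨ f = e) ∧
    e ≠ trivialIdempotent F G ∧
    d = Module.finrank F (Ideal.span {e} : Ideal (MonoidAlgebra F G))}

end Mu

section Codes

variable {F G : Type*} [Field F] [CommGroup G] [Fintype G]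

/-- The Hermitian inner product `∑ a_g b_g^q` on `FG`, for `F` a field with `q²` elements. -/
def hermInner (q : ℕ) (a b : MonoidAlgebra F G) : F :=
  ∑ g : G, a.coeff g * (b.coeff g) ^ q

/-- The Hermitian dual of a code in `(FG)²`, for the form
`⟨(a, b), (a', b')⟩ = ⟨a, a'⟩ + ⟨b, b'⟩`. -/
def hermDual (q : ℕ) (C : TwoQuasiAbelianCode F G) :
    Set (MonoidAlgebra F G × MonoidAlgebra F G) :=
  {x | ∀ c ∈ C, hermInner q x.1 c.1 + hermInner q x.2 c.2 = 0}

/-- `C` is Hermitian LCD: it meets its Hermitian dual trivially. -/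
def IsHermitianLCD (q : ℕ) (C : TwoQuasiAbelianCode F G) : Prop :=
  (C : Set (MonoidAlgebra F G × MonoidAlgebra F G)) ∩ hermDual q C = {0}

/-- The Hamming weight of `(a, b) ∈ (FG)²`, viewed as a word of length `2|G|` over `F`. -/
def hammingWeight (x : MonoidAlgebra F G × MonoidAlgebra F G) : ℕ :=
  x.1.coeff.support.card + x.2.coeff.support.card

/-- The minimum Hamming weight of the nonzero words of `C`, i.e. its minimum distance. -/
def minWeight (C : TwoQuasiAbelianCode F G) : ℕ :=
  sInf {w : ℕ | ∃ x ∈ C, x ≠ 0 ∧ w = hammingWeight x}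

/-- The relative minimum distance `Δ(C) = wt(C) / (2|G|)`. -/
def relMinDist (C : TwoQuasiAbelianCode F G) : ℝ :=
  (minWeight C : ℝ) / ((2 * Fintype.card G : ℕ) : ℝ)

/-- The rate `R(C) = dim_F C / (2|G|)`. -/
def rate (C : TwoQuasiAbelianCode F G) : ℝ :=
  (Module.finrank F C : ℝ) / ((2 * Fintype.card G : ℕ) : ℝ)

end Codes

/-- A sequence of codes is asymptotically good: the lengths `2|G_i|` tend to infinity, and the
rates and the relative minimum distances are all bounded below by positive constants. -/
def IsAsymptoticallyGood {F : Type*} [Field F] {G : ℕ → Type*} [∀ i, CommGroup (G i)]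
    [∀ i, Fintype (G i)] (C : ∀ i, TwoQuasiAbelianCode F (G i)) : Prop :=
  Tendsto (fun i => 2 * Fintype.card (G i)) atTop atTop ∧
  (∃ ρ : ℝ, 0 < ρ ∧ ∀ i, ρ < rate (C i)) ∧
  (∃ δ : ℝ, 0 < δ ∧ ∀ i, δ < relMinDist (C i))

/-- The `q`-ary entropy function to base `q`,
`h_q(δ) = δ log_q (q - 1) - δ log_q δ - (1 - δ) log_q (1 - δ)`
(the library's `Real.qaryEntropy` is the same expression with natural logarithms). -/
def entropy (q : ℕ) (δ : ℝ) : ℝ := Real.qaryEntropy q δ / Real.log q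

end

end HermitianLCD

namespace HermitianLCD

noncomputable section

/-! The codes are $C_b=\{(u,ub)\}$ with $b$ random in the augmentation ideal, so the rate is
automatically $1/2$. Write $\bar b=\sum f(b_g)g^{-1}$ with $f(x)=x^q$, and $Q=q^2$. The algebra
$\mathbb FG$ is a product of fields $K_i$ of dimensions $d_i$, one of them the trivial component
$i_0$. A union bound over the components shows that for large $n$ some $b$ avoids both obstructions.

LCD: it suffices that $1+b\bar b$ is not a zero divisor. At $i_0$ it equals $1$, which is why $b$ is
taken of augmentation zero. Elsewhere a proportion of at most $2q^{-d_i}$ of the $b$ fails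
(`card_norm_eq_neg_one_le`).

Distance: let $S$ be the set of nontrivial components on which $u$ is nonzero, and $D=\sum_{i\in
S}d_i$. Then $(u,ub)$ is a pair from an ideal of dimension at most $D+1$. Such an ideal has at most
$n\beta^{2(D+1)}$ pairs of low weight (`card_lowWeight_le`), and each is hit by a proportion of at
most $Q^{-D}$ of the $b$ (`card_mul_eq_le`). Summing over $S\ne\emptyset$ gives
$n\beta^2\bigl(\prod_i(1+(\beta^2/Q)^{d_i})-1\bigr)$. If $S=\emptyset$, then $u$ has constant
coefficients and weight $n>2\delta n$.

The entropy condition yields $\beta<q$, so $\beta^2/Q<1$. Since $d_i\ge\mu$ and $\log n=o(\mu)$, the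
total failure probability tends to $0$. -/

/-! ### Entropy and asymptotic estimates -/

/-- Equivalent to $h_{q^2}(\delta)\le h_q(\delta)$: it transfers the hypothesis on $h_q$ to the
alphabet of size $q^2$. The logarithm of $(q+1)/q$ is at most $q^{-1}\le 1-\delta$, and that of
$q/(q-1)$ is at most $-\log\delta$. -/
lemma mul_log_div_le_binEntropy {q δ : ℝ} (hq : 2 ≤ q) (h0 : 0 < δ) (h1 : δ ≤ 1 - q⁻¹) :
    δ * (Real.log (q + 1) - Real.log (q - 1)) ≤ Real.binEntropy δ := by
  have hq0 : 0 < q := by linarith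
  have hqi : 0 < q⁻¹ := inv_pos.2 hq0
  have hδ1 : 0 < 1 - δ := by linarith
  have e1 : Real.log (1 - δ) ≤ -δ := by
    have := Real.log_le_sub_one_of_pos hδ1; linarith
  have e2 : Real.log δ ≤ Real.log (q - 1) - Real.log q := by
    rw [← Real.log_div (by linarith) hq0.ne']
    refine Real.log_le_log h0 (h1.trans_eq ?_)
    field_simp
  have e3 : Real.log (q + 1) - Real.log q ≤ q⁻¹ := by
    rw [← Real.log_div (by linarith) hq0.ne']
    have := Real.log_le_sub_one_of_pos (x := (q + 1) / q) (by positivity)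
    have h : (q + 1) / q - 1 = q⁻¹ := by field_simp; ring
    linarith
  rw [Real.binEntropy, Real.log_inv, Real.log_inv]
  have e4 : δ * (Real.log (q + 1) - Real.log (q - 1)) ≤ δ * ((1 - δ) - Real.log δ) :=
    mul_le_mul_of_nonneg_left (by linarith) h0.le
  nlinarith [mul_le_mul_of_nonneg_left e1 hδ1.le]

/-- A Chernoff parameter `z` for words of relative weight `δ` over an alphabet of size `q ^ 2`. -/
lemma exists_chernoff_parameter {q : ℕ} (hq : 2 ≤ q) {δ : ℝ} (h0 : 0 < δ)
    (h1 : δ ≤ 1 - (q : ℝ)⁻¹) (h : entropy q δ < 1 / 2) :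
    ∃ z : ℝ, 0 < z ∧ z ≤ 1 ∧ z ^ (-δ) * (1 + ((q : ℝ) ^ 2 - 1) * z) < q := by
  have hq' : (2 : ℝ) ≤ q := by exact_mod_cast hq
  have hq0 : (0 : ℝ) < q := by linarith
  have hqi : 0 < (q : ℝ)⁻¹ := inv_pos.2 hq0
  have hδ1 : 0 < 1 - δ := by linarith
  have hQ : 0 < (q : ℝ) ^ 2 - 1 := by nlinarith
  have hlq : 0 < Real.log q := Real.log_pos (by linarith)
  -- This $z$ minimises $z^{-\delta}(1+(Q-1)z)$ for $Q=q^2$; the minimum is $Q^{h_Q(\delta)}$.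
  refine ⟨δ / ((1 - δ) * (q ^ 2 - 1)), by positivity, ?_, ?_⟩
  · rw [div_le_one (by positivity)]
    have a1 : (q : ℝ)⁻¹ ≤ 1 - δ := by linarith
    have a2 : (q : ℝ)⁻¹ * ((q : ℝ) ^ 2 - 1) = q - (q : ℝ)⁻¹ := by field_simp
    have a3 : (q : ℝ)⁻¹ ≤ 1 := inv_le_one_of_one_le₀ (by linarith)
    linarith [mul_le_mul_of_nonneg_right a1 hQ.le]
  · have e1 : 1 + ((q : ℝ) ^ 2 - 1) * (δ / ((1 - δ) * (q ^ 2 - 1))) = (1 - δ)⁻¹ := by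
      field_simp; ring
    rw [e1, ← Real.log_lt_log_iff (by positivity) hq0, Real.log_mul (by positivity) (by positivity),
      Real.log_rpow (by positivity), Real.log_div h0.ne' (by positivity),
      Real.log_mul hδ1.ne' hQ.ne', Real.log_inv]
    have e2 : Real.log ((q : ℝ) ^ 2 - 1) = Real.log (q + 1) + Real.log (q - 1) := by
      rw [← Real.log_mul (by linarith) (by linarith)]; ring_nf
    have e3 := mul_log_div_le_binEntropy hq' h0 h1
    rw [entropy, div_lt_iff₀ hlq, Real.qaryEntropy] at h
    push_cast at h
    rw [e2]
    have e4 : Real.binEntropy δ = -(δ * Real.log δ) - (1 - δ) * Real.log (1 - δ) := by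
      rw [Real.binEntropy, Real.log_inv, Real.log_inv]; ring
    rw [e4] at e3 h
    linarith

/-- The entropy increases up to $1-q^{-1}$, and $h_q(1/2)=\tfrac12\log_q(4(q-1))\ge\tfrac12$. -/
lemma lt_half_of_entropy_lt {q : ℕ} (hq : 2 ≤ q) {δ : ℝ}
    (h1 : δ ≤ 1 - (q : ℝ)⁻¹) (h : entropy q δ < 1 / 2) : δ < 1 / 2 := by
  have hq' : (2 : ℝ) ≤ q := by exact_mod_cast hq
  have hlq : 0 < Real.log q := Real.log_pos (by linarith)
  by_contra! hδ
  have hi : (q : ℝ)⁻¹ ≤ 1 / 2 := by rw [inv_le_comm₀] <;> norm_num <;> linarith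
  have := (Real.qaryEntropy_strictMonoOn hq).monotoneOn (a := 1 / 2) (b := δ)
    ⟨by norm_num, by rw [one_div (q : ℝ)]; linarith⟩
    ⟨by linarith, by rw [one_div (q : ℝ)]; linarith⟩ hδ
  rw [entropy, div_lt_iff₀ hlq] at h
  have e : Real.qaryEntropy q (1 / 2) = 1 / 2 * Real.log (q - 1) + Real.log 2 := by
    rw [Real.qaryEntropy, one_div, Real.binEntropy_two_inv]; push_cast; ring
  have e2 : Real.log q ≤ Real.log (2 ^ 2 * (q - 1)) := Real.log_le_log (by linarith) (by linarith)
  rw [Real.log_mul (by norm_num) (by linarith), Real.log_pow] at e2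
  push_cast at e2
  linarith

/-- At $\delta=0$ the Chernoff parameter degenerates to $0$, and asymptotic goodness needs a
positive bound on the distance. -/
lemma exists_pos_entropy_lt {q : ℕ} (hq : 2 ≤ q) {δ : ℝ} (h0 : 0 ≤ δ)
    (h1 : δ ≤ 1 - (q : ℝ)⁻¹) (h : entropy q δ < 1 / 2) :
    ∃ δ' : ℝ, δ ≤ δ' ∧ 0 < δ' ∧ δ' ≤ 1 - (q : ℝ)⁻¹ ∧ entropy q δ' < 1 / 2 := by
  rcases h0.eq_or_lt with rfl | h0
  · have hq' : (2 : ℝ) ≤ q := by exact_mod_cast hq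
    have hi : (q : ℝ)⁻¹ ≤ 1 / 2 := by rw [inv_le_comm₀] <;> norm_num <;> linarith
    have hc : Continuous (entropy q) := by
      unfold entropy; exact Real.qaryEntropy_continuous.div_const _
    have h1 : ∀ᶠ x in 𝓝[>] (0 : ℝ), entropy q x < 1 / 2 :=
      (hc.tendsto 0).mono_left nhdsWithin_le_nhds |>.eventually_lt_const h
    have h2 : ∀ᶠ x in 𝓝[>] (0 : ℝ), x < 1 / 2 :=
      (tendsto_id.mono_left nhdsWithin_le_nhds).eventually_lt_const (by norm_num)
    obtain ⟨x, hx, hx2, hx0⟩ := (h1.and (h2.and self_mem_nhdsWithin)).exists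
    exact ⟨x, le_of_lt hx0, hx0, by linarith, hx⟩
  · exact ⟨δ, le_rfl, h0, h1, h⟩

lemma exists_pos_forall_lt {f : ℕ → ℝ} (hf : ∀ i, 0 < f i) {c : ℝ} (hc : 0 < c)
    (h : ∀ᶠ i in atTop, c < f i) : ∃ d : ℝ, 0 < d ∧ ∀ i, d < f i := by
  obtain ⟨N, hN⟩ := eventually_atTop.1 h
  have key : ∀ N : ℕ, ∃ d : ℝ, 0 < d ∧ d ≤ c ∧ ∀ i < N, d < f i := by
    intro N
    induction N with
    | zero => exact ⟨c, hc, le_rfl, by simp⟩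
    | succ N ih =>
      obtain ⟨d, hd, hdc, hi⟩ := ih
      have : 0 < f N := hf N
      refine ⟨min d (f N / 2), by positivity, (min_le_left _ _).trans hdc, fun i hiN => ?_⟩
      rcases Nat.lt_succ_iff_lt_or_eq.1 hiN with h | rfl
      · exact (min_le_left _ _).trans_lt (hi i h)
      · exact (min_le_right _ _).trans_lt (by linarith)
  obtain ⟨d, hd, hdc, hi⟩ := key N
  exact ⟨d, hd, fun i => (lt_or_ge i N).elim (hi i) fun h => hdc.trans_lt (hN i h)⟩

/-- The numerical estimate that makes the union bound work for large `n`. -/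
lemma eventually_failure_lt_one {q : ℕ} (hq : 2 ≤ q) {n μ : ℕ → ℕ} (hn : Tendsto n atTop atTop)
    (hμ : Tendsto (fun i => Real.logb q (n i) / (μ i : ℝ)) atTop (𝓝 0))
    (hpos : ∀ i, 1 < n i → 0 < μ i) {x c : ℝ} (hx0 : 0 < x) (hx1 : x < 1) (hc : 0 ≤ c) :
    ∀ᶠ i in atTop, 2 * n i * ((q : ℝ)⁻¹) ^ μ i +
      n i * c * (Real.exp (n i * x ^ μ i) - 1) < 1 := by
  have hq' : (2 : ℝ) ≤ q := by exact_mod_cast hq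
  have hlq : 0 < Real.log q := Real.log_pos (by linarith)
  have hqi : (q : ℝ)⁻¹ < 1 := inv_lt_one_of_one_lt₀ (by linarith)
  have hqi0 : 0 < (q : ℝ)⁻¹ := by positivity
  set y := max x (q : ℝ)⁻¹ with hy
  have hy0 : 0 < y := lt_max_of_lt_left hx0
  have hy1 : y < 1 := max_lt hx1 hqi
  have hly : 0 < - Real.log y := by have := Real.log_neg hy0 hy1; linarith
  have hε : 0 < - Real.log y / (3 * Real.log q) := by positivity
  have hnR : Tendsto (fun i => (n i : ℝ)) atTop atTop := tendsto_natCast_atTop_atTop.comp hn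
  filter_upwards [hμ.eventually_lt_const hε, hn.eventually_gt_atTop 1,
    hnR.eventually_gt_atTop (2 + 2 * c)] with i h1 h2 h3
  -- Division by zero gives $0$, so `h1` alone would not exclude $\mu=0$.
  have hm : 0 < (μ i : ℝ) := by exact_mod_cast hpos i h2
  have hn1 : (1 : ℝ) < n i := by exact_mod_cast h2
  have hn0 : (0 : ℝ) < n i := by linarith
  -- The cube leaves room for two factors $n$ in the failure bound and a third that absorbs the
  -- constant $2+2c$.
  have key : (n i : ℝ) ^ 3 * y ^ μ i ≤ 1 := by
    rw [← Real.log_nonpos_iff (by positivity), Real.log_mul (by positivity) (by positivity),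
      Real.log_pow, Real.log_pow]
    rw [Real.logb, div_div, div_lt_div_iff₀ (by positivity) (by positivity)] at h1
    have : Real.log q * (3 * Real.log (n i)) < Real.log q * (-(Real.log y * μ i)) := by linarith
    have := lt_of_mul_lt_mul_left this hlq.le
    push_cast
    linarith
  have hxy : x ^ μ i ≤ y ^ μ i := pow_le_pow_left₀ hx0.le (le_max_left _ _) _
  have hqy : ((q : ℝ)⁻¹) ^ μ i ≤ y ^ μ i := pow_le_pow_left₀ hqi0.le (le_max_right _ _) _
  set Y := y ^ μ i
  have hY : 0 < Y := by positivity
  have hnY : (n i : ℝ) * Y ≤ 1 := by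
    refine le_trans ?_ key
    have : (n i : ℝ) ≤ n i ^ 3 := le_self_pow₀ hn1.le (by norm_num)
    gcongr
  have hexp : Real.exp (n i * x ^ μ i) - 1 ≤ 2 * (n i * Y) := by
    have a := Real.abs_exp_sub_one_le (x := n i * Y) (by rw [abs_of_pos (by positivity)]; exact hnY)
    rw [abs_of_pos (by positivity : 0 < n i * Y)] at a
    have b : Real.exp (n i * x ^ μ i) ≤ Real.exp (n i * Y) := Real.exp_le_exp.2 (by gcongr)
    linarith [le_abs_self (Real.exp (n i * Y) - 1)]
  calc 2 * n i * ((q : ℝ)⁻¹) ^ μ i + n i * c * (Real.exp (n i * x ^ μ i) - 1)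
      ≤ 2 * n i * Y + n i * c * (2 * (n i * Y)) := by gcongr
    _ ≤ (2 + 2 * c) * (n i ^ 2 * Y) := by
        have : (n i : ℝ) * Y ≤ n i ^ 2 * Y := by
          gcongr; exact le_self_pow₀ hn1.le (by norm_num)
        nlinarith
    _ < n i * (n i ^ 2 * Y) := by gcongr
    _ = n i ^ 3 * Y := by ring
    _ ≤ 1 := key

/-! ### Counting words of low weight in an ideal -/

/-- A subspace of `F ^ ι` has an information set. -/
lemma exists_information_set {F ι V : Type*} [Field F] [AddCommGroup V] [Module F V]
    [FiniteDimensional F V] (f : V →ₗ[F] ι → F) (hf : Function.Injective f) :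
    ∃ J : Finset ι, J.card = Module.finrank F V ∧
      ∀ v : V, (∀ j ∈ J, f v j = 0) → v = 0 := by
  classical
  let l : ι → Module.Dual F V := fun i => (LinearMap.proj i).comp f
  -- A maximal independent family of coordinate functionals: a vector killed by it is killed by
  -- every coordinate.
  obtain ⟨κ, a, ha, hspan, hli⟩ := exists_linearIndependent' F l
  have := hli.finite
  have := Fintype.ofFinite κ
  have hinj : ∀ v : V, (∀ k, f v (a k) = 0) → v = 0 := by
    intro v hv
    have h : Submodule.span F (Set.range (l ∘ a)) ≤ LinearMap.ker (Module.Dual.eval F V v) := by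
      rw [Submodule.span_le]
      rintro _ ⟨k, rfl⟩
      exact hv k
    apply hf
    rw [map_zero]
    funext i
    have : l i ∈ Submodule.span F (Set.range (l ∘ a)) :=
      hspan ▸ Submodule.subset_span ⟨i, rfl⟩
    exact h this
  refine ⟨Finset.univ.map ⟨a, ha⟩, ?_, fun v hv => hinj v fun k => hv _ (by simp)⟩
  rw [Finset.card_map, Finset.card_univ]
  apply le_antisymm
  · rw [← Subspace.dual_finrank_eq (K := F) (V := V)]
    exact hli.fintype_card_le_finrank
  · have h : Function.Injective ((LinearMap.funLeft F F a).comp f) := by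
      rw [injective_iff_map_eq_zero]
      exact fun v hv => hinj v fun k => congrFun hv k
    simpa using LinearMap.finrank_le_finrank_of_injective h

lemma sum_prod_ite {F κ : Type*} [Field F] [Fintype F] [DecidableEq F] [Fintype κ] [DecidableEq κ]
    (z : ℝ) : ∑ x : κ → F, ∏ j, (if x j ≠ 0 then z else 1) =
      (1 + ((Fintype.card F : ℝ) - 1) * z) ^ Fintype.card κ := by
  have h : ∑ a : F, (if a ≠ 0 then z else 1) = 1 + ((Fintype.card F : ℝ) - 1) * z := by
    rw [← Finset.add_sum_erase _ _ (Finset.mem_univ (0 : F)), if_neg (by simp),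
      Finset.sum_congr rfl fun a ha => if_pos (Finset.ne_of_mem_erase ha), Finset.sum_const,
      Finset.card_erase_of_mem (Finset.mem_univ _), Finset.card_univ, nsmul_eq_mul,
      Nat.cast_sub Fintype.card_pos]
    simp
  rw [← h, ← Finset.card_univ, ← Finset.prod_const, Finset.prod_univ_sum, Fintype.piFinset_univ]

section
variable {F G : Type*} [Field F] [CommGroup G] [Fintype G]

instance : Module.Finite F (MonoidAlgebra F G) := .of_basis (MonoidAlgebra.basis G F)

omit [CommGroup G] in
lemma finrank_monoidAlgebra : Module.finrank F (MonoidAlgebra F G) = Fintype.card G :=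
  Module.finrank_eq_card_basis (MonoidAlgebra.basis G F)

/-- Double counting: each point of the support lies in exactly $|J|$ of the translates $gJ$. -/
lemma sum_translate_eq [DecidableEq F] (u : MonoidAlgebra F G) (J : Finset G) :
    ∑ g : G, (J.filter fun j => u.coeff (g * j) ≠ 0).card = J.card * u.coeff.support.card := by
  simp_rw [Finset.card_filter]
  rw [Finset.sum_comm, ← smul_eq_mul, ← Finset.sum_const]
  refine Finset.sum_congr rfl fun j _ => ?_
  refine (Fintype.sum_equiv (Equiv.mulRight j) (fun g => if u.coeff (g * j) ≠ 0 then 1 else 0)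
    (fun g => if u.coeff g ≠ 0 then 1 else 0) fun g => rfl).trans ?_
  rw [← Finset.card_filter]
  congr 1
  ext; simp

/-- Number of pairs of low relative weight with both entries in an ideal of dimension `k`. -/
lemma card_lowWeight_le [Fintype F] [Fintype (MonoidAlgebra F G)] (I : Ideal (MonoidAlgebra F G))
    {k : ℕ} (hk : Module.finrank F (I.restrictScalars F) = k)
    {δ z : ℝ} (hz0 : 0 < z) (hz1 : z ≤ 1)
    (s : Finset (MonoidAlgebra F G × MonoidAlgebra F G))
    (hs : ∀ p ∈ s, p.1 ∈ I ∧ p.2 ∈ I ∧ (hammingWeight p : ℝ) ≤ δ * (2 * Fintype.card G)) :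
    (s.card : ℝ) ≤ Fintype.card G *
      (z ^ (-δ) * (1 + ((Fintype.card F : ℝ) - 1) * z)) ^ (2 * k) := by
  classical
  obtain ⟨J, hJ, hinj⟩ := exists_information_set (V := I.restrictScalars F)
    (((Finsupp.lcoeFun : (G →₀ F) →ₗ[F] G → F).comp
      (MonoidAlgebra.coeffLinearEquiv F).toLinearMap).comp (I.restrictScalars F).subtype)
    (by
      intro u v h
      ext g
      exact congrFun h g)
  rw [hk] at hJ
  replace hinj : ∀ u ∈ I, (∀ j ∈ J, u.coeff j = 0) → u = 0 := fun u hu h =>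
    congrArg Subtype.val (hinj ⟨u, hu⟩ h)
  let w : G → MonoidAlgebra F G → ℕ := fun g u => (J.filter fun j => u.coeff (g * j) ≠ 0).card
  have hw : ∀ g, ∑ u ∈ Finset.univ.filter (· ∈ I), z ^ w g u ≤
      (1 + ((Fintype.card F : ℝ) - 1) * z) ^ k := by
    intro g
    have e : (1 + ((Fintype.card F : ℝ) - 1) * z) ^ k =
        ∑ x : J → F, ∏ j, (if x j ≠ 0 then z else 1) := by
      rw [sum_prod_ite, Fintype.card_coe, hJ]
    rw [e]
    let r : MonoidAlgebra F G → J → F := fun u j => u.coeff (g * j)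
    -- Every translate $gJ$ is again injective on $I$, because an ideal is stable under
    -- multiplication by $g^{-1}$.
    have hr : Set.InjOn r (Finset.univ.filter (· ∈ I) : Finset (MonoidAlgebra F G)) := by
      intro u hu v hv huv
      simp only [Finset.coe_filter, Finset.mem_univ, true_and, Set.mem_ofPred_eq] at hu hv
      have h1 : MonoidAlgebra.single g⁻¹ (1 : F) * (u - v) = 0 := by
        refine hinj _ (I.mul_mem_left _ (I.sub_mem hu hv)) fun j hj => ?_
        have := congrFun huv ⟨j, hj⟩
        simp only [r] at this
        rw [MonoidAlgebra.coeff_single_mul_apply, inv_inv, MonoidAlgebra.coeff_sub]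
        simp [this]
      have h2 : MonoidAlgebra.single g (1 : F) * (MonoidAlgebra.single g⁻¹ (1 : F) * (u - v)) = 0 :=
        by rw [h1, mul_zero]
      rw [← mul_assoc, MonoidAlgebra.single_mul_single, mul_inv_cancel, mul_one,
        ← MonoidAlgebra.one_def, one_mul] at h2
      exact sub_eq_zero.1 h2
    have e2 : ∀ u, z ^ w g u = ∏ j, (if r u j ≠ 0 then z else 1) := by
      intro u
      rw [Finset.prod_coe_sort J (fun j => if u.coeff (g * j) ≠ 0 then z else 1),
        Finset.prod_ite, Finset.prod_const_one, mul_one, Finset.prod_const]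
    simp_rw [e2]
    rw [← Finset.sum_image (f := fun x : J → F => ∏ j, (if x j ≠ 0 then z else 1)) hr]
    refine Finset.sum_le_sum_of_subset_of_nonneg (Finset.subset_univ _) fun x _ _ => ?_
    exact Finset.prod_nonneg fun j _ => by split_ifs <;> positivity
  have hp : ∀ p ∈ s, 1 ≤ ∑ g : G, z ^ (-δ * (2 * k)) * (z ^ w g p.1 * z ^ w g p.2) := by
    intro p hp
    obtain ⟨-, -, hwt⟩ := hs p hp
    -- Averaging over $g$: on some translate $gJ$ the relative weight is no larger than on the whole
    -- group.
    have : ∃ g ∈ (Finset.univ : Finset G), ((w g p.1 + w g p.2 : ℕ) : ℝ) ≤ δ * (2 * k) := by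
      apply Finset.exists_le_of_sum_le Finset.univ_nonempty
      rw [← Nat.cast_sum, Finset.sum_add_distrib, sum_translate_eq, sum_translate_eq, ← mul_add, hJ,
        Finset.sum_const, Finset.card_univ, nsmul_eq_mul]
      rw [hammingWeight] at hwt
      push_cast at hwt ⊢
      have := mul_le_mul_of_nonneg_left hwt (Nat.cast_nonneg k : (0 : ℝ) ≤ k)
      linarith
    obtain ⟨g, -, hg⟩ := this
    have h1 : 1 ≤ z ^ (-δ * (2 * k)) * (z ^ w g p.1 * z ^ w g p.2) := by
      rw [← pow_add, ← Real.rpow_natCast, ← Real.rpow_add hz0]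
      exact Real.one_le_rpow_of_pos_of_le_one_of_nonpos hz0 hz1 (by linarith)
    exact h1.trans (Finset.single_le_sum (f := fun g =>
      z ^ (-δ * (2 * k)) * (z ^ w g p.1 * z ^ w g p.2)) (fun g _ => by positivity)
      (Finset.mem_univ g))
  have hQ : (1 : ℝ) ≤ Fintype.card F := by exact_mod_cast Fintype.card_pos
  have hsub : s ⊆ (Finset.univ.filter (· ∈ I)) ×ˢ (Finset.univ.filter (· ∈ I)) := by
    intro p hp
    obtain ⟨h1, h2, -⟩ := hs p hp
    simp [h1, h2]
  calc (s.card : ℝ) = ∑ p ∈ s, 1 := by simp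
    _ ≤ ∑ p ∈ s, ∑ g : G, z ^ (-δ * (2 * k)) * (z ^ w g p.1 * z ^ w g p.2) :=
        Finset.sum_le_sum hp
    _ = ∑ g : G, ∑ p ∈ s, z ^ (-δ * (2 * k)) * (z ^ w g p.1 * z ^ w g p.2) := Finset.sum_comm
    _ ≤ ∑ g : G, (z ^ (-δ) * (1 + ((Fintype.card F : ℝ) - 1) * z)) ^ (2 * k) := by
        refine Finset.sum_le_sum fun g _ => ?_
        rw [← Finset.mul_sum, mul_pow, ← Real.rpow_natCast, ← Real.rpow_mul hz0.le, Nat.cast_mul,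
          Nat.cast_two]
        refine mul_le_mul_of_nonneg_left ?_ (by positivity)
        refine (Finset.sum_le_sum_of_subset_of_nonneg hsub fun _ _ _ => by positivity).trans ?_
        rw [Finset.sum_product]
        dsimp only
        rw [← Finset.sum_mul_sum, mul_comm 2, pow_mul, sq]
        have := hw g
        have h0 : 0 ≤ ∑ u ∈ Finset.univ.filter (· ∈ I), z ^ w g u :=
          Finset.sum_nonneg fun _ _ => by positivity
        gcongr
    _ = _ := by rw [Finset.sum_const, Finset.card_univ, nsmul_eq_mul]

end

/-! ### Counting solutions of the norm equation -/

/-- The translates $r(s)+N$ lie in $M$ and are pairwise disjoint, since $g$ takes the value $s$ on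
the one indexed by $s$. -/
lemma card_mul_card_le {H K : Type*} [AddCommGroup H] [AddCommGroup K] (g : H →+ K)
    {S : Finset K} {N M : Finset H} (r : K → H) (hr : ∀ s ∈ S, g (r s) = s)
    (hN : ∀ k ∈ N, g k = 0) (hM : ∀ s ∈ S, ∀ k ∈ N, r s + k ∈ M) : S.card * N.card ≤ M.card := by
  rw [← Finset.card_product]
  refine Finset.card_le_card_of_injOn (fun p => r p.1 + p.2) ?_ ?_
  · rintro ⟨s, k⟩ hp
    obtain ⟨hs, hk⟩ := Finset.mem_product.1 hp
    exact hM s hs k hk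
  · rintro ⟨s, k⟩ hp ⟨s', k'⟩ hp' h
    obtain ⟨hs, hk⟩ := Finset.mem_product.1 hp
    obtain ⟨hs', hk'⟩ := Finset.mem_product.1 hp'
    dsimp only at h hs hk hs' hk'
    have e := congrArg g h
    rw [map_add, map_add, hr s hs, hr s' hs', hN k hk, hN k' hk', add_zero, add_zero] at e
    subst e
    simpa using h

/-- If `ψ` plays the role of a conjugate of `φ`, few elements have norm `φ b * ψ b = -1`. -/
lemma card_norm_eq_neg_one_le {H K : Type*} [AddCommGroup H] [Fintype H] [Field K] [Fintype K]
    [DecidableEq K] (φ ψ : H →+ K) (hφ : Function.Surjective φ) {c : K} (hc : c ≠ 0) (t : H → H)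
    (ht : ∀ b, φ (t b) = c * (φ b + ψ b)) (ht' : ∀ b, ψ (t b) = -(c * (φ b + ψ b))) :
    (Finset.univ.filter fun b : H => φ b * ψ b = -1).card ^ 2 * Fintype.card K ≤
      4 * Fintype.card H ^ 2 := by
  classical
  set bad := Finset.univ.filter fun b : H => φ b * ψ b = -1
  let T : H →+ K := φ + ψ
  set W := Finset.univ.image T with hW
  set kf := Finset.univ.filter fun b : H => φ b = 0 ∧ ψ b = 0 with hkf
  set kT := Finset.univ.filter fun b : H => T b = 0 with hkT
  have hT : ∀ b, T b = φ b + ψ b := fun b => rfl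
  -- For fixed trace $s$, the value $\varphi(b)$ is a root of the quadratic $x(s-x)=-1$; trace and
  -- $\varphi(b)$ together determine $b$ modulo the joint kernel.
  have hA : bad.card ≤ 2 * kf.card * W.card := by
    refine Finset.card_le_mul_card_image_of_maps_to (f := T) (fun b _ => by simp [hW]) _ ?_
    intro s _
    have hR : (Finset.univ.filter fun x : K => x * (s - x) = -1).card ≤ 2 := by
      by_contra! h
      obtain ⟨x, y, w, hx, hy, hw, hxy, hxw, hyw⟩ := Finset.two_lt_card_iff.1 h
      simp only [Finset.mem_filter, Finset.mem_univ, true_and] at hx hy hw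
      have h1 : (x - y) * (s - x - y) = 0 := by linear_combination hx - hy
      have h2 : (x - w) * (s - x - w) = 0 := by linear_combination hx - hw
      have h1' := (mul_eq_zero.1 h1).resolve_left (sub_ne_zero.2 hxy)
      have h2' := (mul_eq_zero.1 h2).resolve_left (sub_ne_zero.2 hxw)
      exact hyw (by linear_combination h2' - h1')
    rw [mul_comm 2]
    refine le_trans ?_ (Nat.mul_le_mul_left _ hR)
    refine Finset.card_le_mul_card_image_of_maps_to (f := φ) ?_ _ ?_
    · intro b hb
      simp only [bad, Finset.mem_filter, Finset.mem_univ, true_and] at hb ⊢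
      rw [← hb.2, hT, add_sub_cancel_left, hb.1]
    · intro x _
      rcases Finset.eq_empty_or_nonempty
        (((bad.filter fun b => T b = s)).filter fun b => φ b = x) with h | ⟨b₀, hb₀⟩
      · rw [h]; simp
      · refine Finset.card_le_card_of_injOn (fun b => b - b₀) ?_ (sub_left_injective.injOn)
        intro b hb
        simp only [hT, Finset.coe_filter, Finset.mem_filter, Set.mem_ofPred_eq, hkf,
          Finset.mem_univ, true_and, map_sub] at hb hb₀ ⊢
        have e : φ b = φ b₀ := hb.2.trans hb₀.2.symm
        refine ⟨by rw [e, sub_self], ?_⟩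
        have := hb.1.2.trans hb₀.1.2.symm
        rw [e] at this
        rw [add_left_cancel this, sub_self]
  -- The elements $t(b)$ have trace zero and $\varphi(t(b))=c\,T(b)$, so $\varphi$ takes at least
  -- $|W|$ values on the kernel of $T$. This treats alike the components fixed by conjugation and
  -- those it permutes.
  have hB : W.card * kf.card ≤ kT.card := by
    rw [← Finset.card_image_of_injective W (mul_right_injective₀ hc)]
    have : ∀ s ∈ W.image (c * ·), ∃ b, φ (t b) = s := by
      intro s hs
      simp only [hW, Finset.mem_image, Finset.mem_univ, true_and] at hs
      obtain ⟨_, ⟨b, rfl⟩, rfl⟩ := hs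
      exact ⟨b, ht b⟩
    choose! r hr using this
    refine card_mul_card_le φ (fun s => t (r s)) hr ?_ ?_
    · intro k hk
      exact (Finset.mem_filter.1 hk).2.1
    · intro s _ k hk
      have := (Finset.mem_filter.1 hk).2
      simp only [hkT, hT, Finset.mem_filter, Finset.mem_univ, true_and, map_add, ht, ht', this.1,
        this.2]
      ring
  have hC : W.card * kT.card ≤ Fintype.card H := by
    have : ∀ s ∈ W, ∃ b, T b = s := by simp [hW]
    choose! r hr using this
    exact card_mul_card_le T r hr (fun k hk => (Finset.mem_filter.1 hk).2) fun _ _ _ _ =>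
      Finset.mem_univ _
  have hD : Fintype.card K * kf.card ≤ Fintype.card H := by
    choose r hr using hφ
    exact card_mul_card_le φ r (fun s _ => hr s) (fun k hk => (Finset.mem_filter.1 hk).2.1)
      fun _ _ _ _ => Finset.mem_univ _
  calc bad.card ^ 2 * Fintype.card K ≤ (2 * kf.card * W.card) ^ 2 * Fintype.card K := by gcongr
    _ = 4 * (W.card * (W.card * kf.card)) * (Fintype.card K * kf.card) := by ring
    _ ≤ 4 * (W.card * kT.card) * (Fintype.card K * kf.card) := by gcongr
    _ ≤ 4 * Fintype.card H * Fintype.card H := by gcongr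
    _ = 4 * Fintype.card H ^ 2 := by ring

/-! ### Conjugation and augmentation -/

lemma exists_frobenius {F : Type*} [Field F] [Fintype F] {q : ℕ} (hq : IsPrimePow q)
    (hF : Fintype.card F = q ^ 2) : ∃ f : F →+* F, ∀ x, f x = x ^ q := by
  obtain ⟨p, k, hp, hk, rfl⟩ := hq
  have hp' := hp.nat_prime
  have : Fact p.Prime := ⟨hp'⟩
  rw [← pow_mul] at hF
  have : CharP F p := by
    exact charP_of_card_eq_prime_pow hF
  exact ⟨iterateFrobenius F p k, fun x => iterateFrobenius_def ..⟩

/-- A nonzero scalar with `x ^ q = -x`. -/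
lemma exists_ne_zero_pow_eq_neg {F : Type*} [Field F] [Fintype F] {q : ℕ} (hq : 2 ≤ q)
    (hF : Fintype.card F = q ^ 2) {f : F →+* F} (hf : ∀ x, f x = x ^ q) :
    ∃ c : F, c ≠ 0 ∧ f c = -c := by
  have hff : ∀ x, f (f x) = x := fun x => by rw [hf, hf, ← pow_mul, ← sq, ← hF, FiniteField.pow_card]
  -- The fixed points of $f$ are roots of $X^q-X$, at most $q<q^2$ in number.
  have : ∃ a, f a ≠ a := by
    by_contra! h
    have hP : (Polynomial.X ^ q - Polynomial.X : Polynomial F) ≠ 0 :=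
      FiniteField.X_pow_card_sub_X_ne_zero F (by omega)
    have := Polynomial.card_le_degree_of_subset_roots (p := Polynomial.X ^ q - Polynomial.X)
      (Z := (Finset.univ : Finset F)) (fun a _ => by
        rw [Polynomial.mem_roots hP]
        simp [Polynomial.IsRoot, ← hf, h])
    rw [FiniteField.X_pow_card_sub_X_natDegree_eq F (by omega), Finset.card_univ, hF] at this
    nlinarith
  obtain ⟨a, ha⟩ := this
  exact ⟨a - f a, sub_ne_zero.2 (Ne.symm ha), by rw [map_sub, hff]; ring⟩

section
variable {F G : Type*} [Field F] [CommGroup G]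

/-- The conjugation `∑ a_g g ↦ ∑ f(a_g) g⁻¹` of the group algebra. -/
def conj (f : F →+* F) : MonoidAlgebra F G →+* MonoidAlgebra F G :=
  (MonoidAlgebra.mapDomainRingHom F (invMonoidHom : G →* G)).comp (MonoidAlgebra.mapRingHom G f)

@[simp] lemma conj_single (f : F →+* F) (g : G) (r : F) :
    conj f (MonoidAlgebra.single g r) = MonoidAlgebra.single g⁻¹ (f r) := by
  simp [conj]

lemma coeff_conj (f : F →+* F) (a : MonoidAlgebra F G) (g : G) :
    (conj f a).coeff g = f (a.coeff g⁻¹) := by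
  induction a using MonoidAlgebra.induction_linear with
  | zero => simp
  | add x y hx hy => simp [hx, hy]
  | single h r =>
    classical
    rw [conj_single, MonoidAlgebra.coeff_single, MonoidAlgebra.coeff_single, Finsupp.single_apply,
      Finsupp.single_apply, apply_ite f, map_zero]
    simp [inv_eq_iff_eq_inv]

lemma conj_conj {f : F →+* F} (hf : ∀ x, f (f x) = x) (a : MonoidAlgebra F G) :
    conj f (conj f a) = a := by
  ext g
  simp [coeff_conj, hf]

lemma conj_smul (f : F →+* F) (c : F) (a : MonoidAlgebra F G) :
    conj f (c • a) = f c • conj f a := by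
  ext g
  simp [coeff_conj]

variable [Fintype G]

lemma hermInner_eq {q : ℕ} {f : F →+* F} (hf : ∀ x, f x = x ^ q) (a b : MonoidAlgebra F G) :
    hermInner q a b = (a * conj f b).coeff 1 := by
  rw [MonoidAlgebra.coeff_mul_apply_left, Finsupp.sum_fintype _ _ (by simp)]
  simp [hermInner, coeff_conj, hf]

/-- The augmentation `∑ a_g g ↦ ∑ a_g`. -/
def aug : MonoidAlgebra F G →ₐ[F] F := MonoidAlgebra.lift F F G 1

omit [Fintype G] in
@[simp] lemma aug_single (g : G) (r : F) : aug (MonoidAlgebra.single g r) = r := by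
  simp [aug]

omit [Fintype G] in
lemma aug_conj (f : F →+* F) (a : MonoidAlgebra F G) : aug (conj f a) = f (aug a) := by
  induction a using MonoidAlgebra.induction_linear with
  | zero => simp
  | add x y hx hy => simp [hx, hy]
  | single h r => simp

end

/-! ### Codes generated by $(1,b)$ -/

section
variable {F G : Type*} [Field F] [CommGroup G]

/-- The code `{(u, u b)}` generated by `(1, b)`. -/
def graphCode (b : MonoidAlgebra F G) : TwoQuasiAbelianCode F G :=
  LinearMap.range (LinearMap.id.prod (LinearMap.toSpanSingleton _ _ b))

lemma mem_graphCode {b : MonoidAlgebra F G} {x : MonoidAlgebra F G × MonoidAlgebra F G} :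
    x ∈ graphCode b ↔ ∃ u, (u, u * b) = x := by
  simp [graphCode, LinearMap.mem_range]

variable [Fintype G]

lemma rate_graphCode (b : MonoidAlgebra F G) : rate (graphCode b) = 1 / 2 := by
  have h : Module.finrank F (graphCode b) = Fintype.card G := by
    rw [← finrank_monoidAlgebra (F := F) (G := G)]
    let e : MonoidAlgebra F G →ₗ[F] graphCode b :=
      { toFun := fun u => ⟨(u, u * b), mem_graphCode.2 ⟨u, rfl⟩⟩
        map_add' := fun u v => Subtype.ext (Prod.ext rfl (add_mul u v b))
        map_smul' := fun c u => Subtype.ext (Prod.ext rfl (smul_mul_assoc c u b)) }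
    refine (LinearEquiv.finrank_eq (LinearEquiv.ofBijective e ⟨fun u v h => ?_, ?_⟩)).symm
    · exact congrArg Prod.fst (congrArg Subtype.val h)
    · rintro ⟨x, hx⟩
      obtain ⟨u, rfl⟩ := mem_graphCode.1 hx
      exact ⟨u, rfl⟩
  have : (Fintype.card G : ℝ) ≠ 0 := by exact_mod_cast Fintype.card_ne_zero
  rw [rate, h]
  push_cast
  field_simp

/-- Pairing $(u,ub)$ with $(g,gb)$ gives the coefficient of $u(1+b\bar b)$ at $g$, so orthogonality
to the whole code means that this product vanishes. -/
lemma isHermitianLCD_graphCode {q : ℕ} {f : F →+* F} (hf : ∀ x, f x = x ^ q)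
    {b : MonoidAlgebra F G} (hb : ∀ u, u * (1 + b * conj f b) = 0 → u = 0) :
    IsHermitianLCD q (graphCode b) := by
  apply Set.eq_singleton_iff_unique_mem.2
  constructor
  · refine ⟨Submodule.zero_mem _, fun c _ => ?_⟩
    simp [hermInner]
  · rintro x ⟨hx, hd⟩
    obtain ⟨u, rfl⟩ := mem_graphCode.1 hx
    have : u = 0 := by
      apply hb
      ext g
      have := hd (MonoidAlgebra.single g 1, MonoidAlgebra.single g 1 * b)
        (mem_graphCode.2 ⟨_, rfl⟩)
      dsimp only at this
      rw [hermInner_eq hf, hermInner_eq hf, ← Finsupp.add_apply, ← MonoidAlgebra.coeff_add,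
        map_mul, conj_single, map_one f] at this
      have e : u * MonoidAlgebra.single g⁻¹ 1 + u * b * (MonoidAlgebra.single g⁻¹ 1 * conj f b) =
        u * (1 + b * conj f b) * MonoidAlgebra.single g⁻¹ 1 := by ring
      rw [e, MonoidAlgebra.coeff_mul_single_apply] at this
      simpa using this
    simp [this]

omit [Fintype G] in
lemma hammingWeight_pos {x : MonoidAlgebra F G × MonoidAlgebra F G} (hx : x ≠ 0) :
    0 < hammingWeight x := by
  rw [hammingWeight, Nat.pos_iff_ne_zero]
  intro h
  apply hx
  simp only [Nat.add_eq_zero_iff, Finset.card_eq_zero, Finsupp.support_eq_empty,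
    MonoidAlgebra.coeff_eq_zero] at h
  exact Prod.ext h.1 h.2

omit [Fintype G] in
lemma exists_minWeight_graphCode (b : MonoidAlgebra F G) :
    ∃ u : MonoidAlgebra F G, u ≠ 0 ∧ minWeight (graphCode b) = hammingWeight (u, u * b) := by
  have hne : {w : ℕ | ∃ x ∈ graphCode b, x ≠ 0 ∧ w = hammingWeight x}.Nonempty :=
    ⟨_, (1, 1 * b), mem_graphCode.2 ⟨1, rfl⟩, by simp, rfl⟩
  obtain ⟨x, hx, hx0, hw⟩ := Nat.sInf_mem hne
  obtain ⟨u, rfl⟩ := mem_graphCode.1 hx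
  exact ⟨u, fun h => hx0 (by simp [h]), hw⟩

lemma relMinDist_graphCode_pos (b : MonoidAlgebra F G) : 0 < relMinDist (graphCode b) := by
  obtain ⟨u, hu, h⟩ := exists_minWeight_graphCode b
  have : 0 < hammingWeight (u, u * b) := hammingWeight_pos (by simp [hu])
  rw [relMinDist, h]
  have : 0 < Fintype.card G := Fintype.card_pos
  positivity

lemma lt_relMinDist_graphCode {b : MonoidAlgebra F G} {δ : ℝ}
    (h : ∀ u, u ≠ 0 → δ * (2 * Fintype.card G) < hammingWeight (u, u * b)) :
    δ < relMinDist (graphCode b) := by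
  obtain ⟨u, hu, hw⟩ := exists_minWeight_graphCode b
  have : 0 < Fintype.card G := Fintype.card_pos
  rw [relMinDist, hw, lt_div_iff₀ (by positivity)]
  push_cast
  exact h u hu

/-- Invariance under all translations makes the coefficients constant. -/
lemma card_support_of_mul_eq_zero {u : MonoidAlgebra F G} (hu : u ≠ 0)
    (h : ∀ g : G, u * (MonoidAlgebra.single g 1 - 1) = 0) :
    u.coeff.support.card = Fintype.card G := by
  have hc : ∀ g, u.coeff g = u.coeff 1 := by
    intro g
    have := congrArg (fun x => x.coeff g) (h g)
    simp only [mul_sub, mul_one, MonoidAlgebra.coeff_sub, Finsupp.sub_apply,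
      MonoidAlgebra.coeff_mul_single_apply, mul_inv_cancel, MonoidAlgebra.coeff_zero,
      Finsupp.zero_apply] at this
    exact (sub_eq_zero.1 this).symm
  have h1 : u.coeff 1 ≠ 0 := by
    intro h1
    apply hu
    ext g
    simp [hc g, h1]
  have : u.coeff.support = Finset.univ := by
    ext g
    simp [hc g, h1]
  rw [this, Finset.card_univ]

end

/-! ### Union bound over the field components -/

section
variable {F G : Type*} [Field F] [Fintype F] [CommGroup G] [Fintype G]
  {ι : Type*} [Fintype ι] [DecidableEq ι] {K : ι → Type*} [∀ i, Field (K i)] [∀ i, Algebra F (K i)]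
  [∀ i, Fintype (K i)] (φ : MonoidAlgebra F G ≃ₐ[F] ∀ i, K i) (i₀ : ι)
  (h₀ : ∀ a, φ a i₀ = 0 ↔ aug a = 0)

include h₀ in
omit [Fintype F] [Fintype G] [Fintype ι] [DecidableEq ι] [∀ i, Fintype (K i)] in
-- The projection to $K_{i_0}$ has the same kernel as the augmentation, whose image is $F$.
lemma finrank_trivial_component : Module.finrank F (K i₀) = 1 := by
  classical
  refine finrank_eq_one (1 : K i₀) one_ne_zero fun w => ?_
  let a := φ.symm (Pi.single i₀ w)
  have ha : φ a i₀ = w := by simp [a]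
  refine ⟨aug a, ?_⟩
  have : φ (a - aug a • 1) i₀ = 0 := by
    rw [h₀, map_sub, map_smul, map_one, smul_eq_mul, mul_one, sub_self]
  rw [map_sub, Pi.sub_apply, ha, map_smul, Pi.smul_apply, map_one, Pi.one_apply] at this
  exact (sub_eq_zero.1 this).symm

/-- The ideal of elements supported on the components in `S` and the trivial one. -/
def componentIdeal (S : Finset ι) : Ideal (MonoidAlgebra F G) where
  carrier := {u | ∀ i ∉ insert i₀ S, φ u i = 0}
  zero_mem' i _ := by simp
  add_mem' ha hb i hi := by simp [ha i hi, hb i hi]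
  smul_mem' c x hx i hi := by simp [hx i hi]

include h₀ in
omit [Fintype F] in
-- The extra $1$ is the trivial component: $b$ vanishes there, but $u$ need not.
lemma finrank_componentIdeal_le {S : Finset ι} (hS : i₀ ∉ S) :
    Module.finrank F ((componentIdeal φ i₀ S).restrictScalars F) ≤
      ∑ i ∈ S, Module.finrank F (K i) + 1 := by
  have : ∀ i, Module.Finite F (K i) := fun i => .of_surjective
    ((LinearMap.proj i).comp φ.toLinearMap) fun w => ⟨φ.symm (Pi.single i w), by simp⟩
  let r : (componentIdeal φ i₀ S).restrictScalars F →ₗ[F] ∀ i : ↥(insert i₀ S), K i :=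
    LinearMap.pi fun i => ((LinearMap.proj (i : ι)).comp φ.toLinearMap).comp
      ((componentIdeal φ i₀ S).restrictScalars F).subtype
  have hr : Function.Injective r := by
    rw [injective_iff_map_eq_zero]
    rintro ⟨u, hu⟩ h
    ext1
    apply φ.injective
    rw [ZeroMemClass.coe_zero, map_zero]
    funext i
    by_cases hi : i ∈ insert i₀ S
    · exact congrFun h ⟨i, hi⟩
    · exact hu i hi
  refine (LinearMap.finrank_le_finrank_of_injective hr).trans ?_
  rw [Module.finrank_pi_fintype, Finset.sum_coe_sort (insert i₀ S) fun i => Module.finrank F (K i),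
    Finset.sum_insert hS, finrank_trivial_component φ i₀ h₀, add_comm]

end

section

variable {F G : Type*} [Field F] [Fintype F] [CommGroup G] [Fintype G]
  {ι : Type*} [Fintype ι] [DecidableEq ι] {K : ι → Type*} [∀ i, Field (K i)] [∀ i, Algebra F (K i)]
  [∀ i, Fintype (K i)] (φ : MonoidAlgebra F G ≃ₐ[F] ∀ i, K i) {i₀ : ι}
  (h₀ : ∀ a, φ a i₀ = 0 ↔ aug a = 0)

variable (F G) in
/-- The augmentation ideal, as a vector space. -/
abbrev augKer : Submodule F (MonoidAlgebra F G) := LinearMap.ker (aug (F := F) (G := G)).toLinearMap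

include h₀ in
omit [Fintype F] [Fintype G] [Fintype ι] [DecidableEq ι] [∀ i, Fintype (K i)] in
lemma symm_mem_augKer {x : ∀ i, K i} (hx : x i₀ = 0) : φ.symm x ∈ augKer F G := by
  rw [LinearMap.mem_ker, AlgHom.toLinearMap_apply, ← h₀, AlgEquiv.apply_symm_apply, hx]

include h₀ in
omit [Fintype G] [Fintype ι] in
-- `card_norm_eq_neg_one_le` is applied with $t(b)=c(b+\bar b)$, where $f(c)=-c\ne0$. Then $t(b)$
-- has augmentation zero and is negated by conjugation.
lemma card_not_isUnit_component_le [Fintype (augKer F G)] [∀ i, DecidableEq (K i)] {q : ℕ}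
    (hq : 2 ≤ q) (hF : Fintype.card F = q ^ 2) {f : F →+* F} (hf : ∀ x, f x = x ^ q)
    {i : ι} (hi : i ≠ i₀) :
    ((Finset.univ.filter fun b : augKer F G => φ b i * φ (conj f b) i = -1).card : ℝ) ≤
      2 * (q : ℝ)⁻¹ ^ Module.finrank F (K i) * Fintype.card (augKer F G) := by
  obtain ⟨c, hc, hfc⟩ := exists_ne_zero_pow_eq_neg hq hF hf
  have hff : ∀ x, f (f x) = x := fun x => by
    rw [hf, hf, ← pow_mul, ← sq, ← hF, FiniteField.pow_card]
  let ev : MonoidAlgebra F G →+ K i :=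
    (Pi.evalAddMonoidHom K i).comp (φ : MonoidAlgebra F G →+ ∀ i, K i)
  let φi : augKer F G →+ K i := ev.comp (augKer F G).subtype.toAddMonoidHom
  let ψi : augKer F G →+ K i :=
    (ev.comp (conj f).toAddMonoidHom).comp (augKer F G).subtype.toAddMonoidHom
  have hφi : ∀ b, φi b = φ b i := fun b => rfl
  have hψi : ∀ b, ψi b = φ (conj f b) i := fun b => rfl
  have key := card_norm_eq_neg_one_le φi ψi (fun w => ⟨⟨_, symm_mem_augKer φ h₀
      (x := Pi.single i w) (Pi.single_eq_of_ne hi.symm w)⟩, by simp [hφi]⟩)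
    (c := algebraMap F (K i) c) (by simpa using hc)
    (fun b => ⟨c • ((b : MonoidAlgebra F G) + conj f (b : MonoidAlgebra F G)), by
      have hb : aug (b : MonoidAlgebra F G) = 0 := b.2
      rw [LinearMap.mem_ker, AlgHom.toLinearMap_apply, map_smul, map_add, aug_conj, hb]
      simp⟩)
    (fun b => by
      rw [hφi, hφi, hψi, map_smul, Pi.smul_apply, Algebra.smul_def, map_add, Pi.add_apply])
    (fun b => by
      rw [hψi, hφi, hψi]
      simp only [conj_smul, map_add, conj_conj hff, hfc, map_smul, Pi.smul_apply, Pi.add_apply]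
      rw [Algebra.smul_def, map_neg, neg_mul, add_comm (φ b i)])
  rw [Module.card_eq_pow_finrank (K := F) (V := K i), hF] at key
  have hq0 : (0 : ℝ) < q := by exact_mod_cast (by omega : 0 < q)
  set N := (Finset.univ.filter fun b : augKer F G => φ b i * φ (conj f b) i = -1).card with hN
  change N ^ 2 * _ ≤ _ at key
  set d := Module.finrank F (K i)
  -- Since $|K_i|=q^{2d}$, the bound is one between squares, and its root gives $q^{-d}$.
  have key2 : (N * q ^ d) ^ 2 ≤ (2 * Fintype.card (augKer F G)) ^ 2 := by
    calc (N * q ^ d) ^ 2 = N ^ 2 * (q ^ 2) ^ d := by ring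
      _ ≤ _ := key
      _ = _ := by ring
  have key3 := (Nat.pow_le_pow_iff_left two_ne_zero).1 key2
  have key4 : (N : ℝ) * q ^ d ≤ 2 * Fintype.card (augKer F G) := by exact_mod_cast key3
  rw [inv_pow, mul_right_comm, ← div_eq_mul_inv, le_div_iff₀ (by positivity)]
  exact key4

include h₀ in
omit [Fintype G] [Fintype ι] in
/-- Given `u` nonvanishing on the components in `S`, the map `b ↦ u b` has small fibres. -/
lemma card_mul_eq_le [Fintype (augKer F G)] [DecidableEq (MonoidAlgebra F G)]
    {S : Finset ι} (hS : i₀ ∉ S) {u : MonoidAlgebra F G} (hu : ∀ i ∈ S, φ u i ≠ 0)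
    (w : MonoidAlgebra F G) :
    (Finset.univ.filter fun b : augKer F G => u * b = w).card *
      Fintype.card F ^ ∑ i ∈ S, Module.finrank F (K i) ≤ Fintype.card (augKer F G) := by
  classical
  let g : augKer F G →+ ∀ i : S, K i :=
    { toFun := fun b i => φ b i
      map_zero' := by ext; simp
      map_add' := fun a b => by ext; simp }
  set N := Finset.univ.filter fun b : augKer F G => g b = 0 with hN
  have h1 : (Finset.univ.filter fun b : augKer F G => u * b = w).card ≤ N.card := by
    rcases Finset.eq_empty_or_nonempty
      (Finset.univ.filter fun b : augKer F G => u * b = w) with h | ⟨b₀, hb₀⟩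
    · rw [h]; simp
    · refine Finset.card_le_card_of_injOn (fun b => b - b₀) ?_ sub_left_injective.injOn
      intro b hb
      simp only [Finset.coe_filter, Finset.mem_filter, Set.mem_ofPred_eq, hN,
        Finset.mem_univ, true_and] at hb hb₀ ⊢
      funext i
      have e : φ (u * (b - b₀)) i = 0 := by rw [mul_sub, hb, hb₀, sub_self, map_zero]; rfl
      rw [map_mul, Pi.mul_apply] at e
      exact (mul_eq_zero.1 e).resolve_left (hu i i.2)
  have h2 : Fintype.card F ^ ∑ i ∈ S, Module.finrank F (K i) =
      (Finset.univ : Finset (∀ i : S, K i)).card := by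
    rw [Finset.card_univ, Fintype.card_pi, ← Finset.prod_pow_eq_pow_sum,
      ← Finset.prod_coe_sort S fun i => Fintype.card F ^ Module.finrank F (K i)]
    exact Finset.prod_congr rfl fun i _ => (Module.card_eq_pow_finrank (K := F) (V := K i)).symm
  rw [h2, mul_comm]
  -- Extending a family on $S$ by zero gives an element of augmentation zero, as $i_0\notin S$.
  refine (Nat.mul_le_mul_left _ h1).trans ?_
  refine card_mul_card_le g (fun y => ⟨φ.symm fun i => if h : i ∈ S then y ⟨i, h⟩ else 0,
    symm_mem_augKer φ h₀ (dif_neg hS)⟩) ?_ (fun k hk => (Finset.mem_filter.1 hk).2)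
    fun _ _ _ _ => Finset.mem_univ _
  intro y _
  funext i
  simp [g]

include h₀ in
/-- For few `b` does some `u` with component support `S` give a word `(u, u b)` of low weight. -/
lemma card_exists_lowWeight_le [Fintype (augKer F G)] {S : Finset ι} (hS : i₀ ∉ S) {δ z : ℝ}
    (hδ : 0 ≤ δ) (hz0 : 0 < z) (hz1 : z ≤ 1) (s : Finset (augKer F G))
    (hs : ∀ b ∈ s, ∃ u, (∀ i, i ≠ i₀ → (φ u i ≠ 0 ↔ i ∈ S)) ∧
      (hammingWeight (u, u * b) : ℝ) ≤ δ * (2 * Fintype.card G))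
    {β : ℝ} (hβ : β = z ^ (-δ) * (1 + ((Fintype.card F : ℝ) - 1) * z)) :
    (s.card : ℝ) ≤ Fintype.card (augKer F G) * (Fintype.card G * β ^ 2 *
      ∏ i ∈ S, (β ^ 2 / Fintype.card F) ^ Module.finrank F (K i)) := by
  classical
  have : Finite (MonoidAlgebra F G) := Module.finite_of_finite F
  have := Fintype.ofFinite (MonoidAlgebra F G)
  have hQ : (1 : ℝ) ≤ Fintype.card F := by exact_mod_cast Fintype.card_pos
  -- Only an upper bound on the dimension of the ideal is known; $\beta\ge1$ allows the exponent to
  -- be raised to it.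
  have hβ1 : 1 ≤ β := by
    rw [hβ]
    have h1 : 1 ≤ z ^ (-δ) := Real.one_le_rpow_of_pos_of_le_one_of_nonpos hz0 hz1 (by linarith)
    have h2 : 1 ≤ 1 + ((Fintype.card F : ℝ) - 1) * z := by nlinarith
    nlinarith
  set D := ∑ i ∈ S, Module.finrank F (K i) with hD
  let I := componentIdeal φ i₀ S
  let low : Finset (MonoidAlgebra F G × MonoidAlgebra F G) := Finset.univ.filter fun p =>
    p.1 ∈ I ∧ p.2 ∈ I ∧ (∀ i ∈ S, φ p.1 i ≠ 0) ∧
      (hammingWeight p : ℝ) ≤ δ * (2 * Fintype.card G)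
  have hlow : (low.card : ℝ) ≤ Fintype.card G * (β ^ 2) ^ (D + 1) := by
    refine (card_lowWeight_le I rfl (δ := δ) hz0 hz1 low fun p hp => ?_).trans ?_
    · obtain ⟨-, h1, h2, -, h3⟩ := Finset.mem_filter.1 hp
      exact ⟨h1, h2, h3⟩
    · rw [← hβ, ← pow_mul]
      gcongr
      exact finrank_componentIdeal_le φ i₀ h₀ hS
  have hcov : s ⊆ low.biUnion fun p => Finset.univ.filter fun b : augKer F G => p.1 * b = p.2 := by
    intro b hb
    obtain ⟨u, hu, hw⟩ := hs b hb
    have huI : u ∈ I := by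
      intro i hi
      rw [Finset.mem_insert, not_or] at hi
      by_contra h
      exact hi.2 ((hu i hi.1).1 h)
    refine Finset.mem_biUnion.2 ⟨(u, u * b), ?_, by simp⟩
    simp only [low, Finset.mem_filter, Finset.mem_univ, true_and]
    refine ⟨huI, I.mul_mem_right _ huI, fun i hi => ?_, hw⟩
    exact (hu i fun h => hS (h ▸ hi)).2 hi
  have hnat : s.card * Fintype.card F ^ D ≤ low.card * Fintype.card (augKer F G) := by
    calc s.card * Fintype.card F ^ D
        ≤ (∑ p ∈ low, (Finset.univ.filter fun b : augKer F G => p.1 * b = p.2).card) *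
          Fintype.card F ^ D := by
          gcongr
          exact (Finset.card_le_card hcov).trans Finset.card_biUnion_le
      _ ≤ ∑ p ∈ low, Fintype.card (augKer F G) := by
          rw [Finset.sum_mul]
          exact Finset.sum_le_sum fun p hp =>
            card_mul_eq_le φ h₀ hS (Finset.mem_filter.1 hp).2.2.2.1 p.2
      _ = _ := by rw [Finset.sum_const, smul_eq_mul]
  have hreal : (s.card : ℝ) * (Fintype.card F : ℝ) ^ D ≤ low.card * Fintype.card (augKer F G) := by
    exact_mod_cast hnat
  rw [Finset.prod_pow_eq_pow_sum, ← hD, div_pow, ← mul_div_assoc, ← mul_div_assoc,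
    le_div_iff₀ (by positivity)]
  calc _ ≤ _ := hreal
    _ ≤ Fintype.card G * (β ^ 2) ^ (D + 1) * Fintype.card (augKer F G) := by gcongr
    _ = _ := by ring

include h₀ in
/-- The probabilistic existence statement: if the union bound is nontrivial, some `(1, b)`
generates a Hermitian LCD code of large minimum distance. -/
theorem exists_good_generator {q : ℕ} (hq : 2 ≤ q) (hF : Fintype.card F = q ^ 2) {f : F →+* F}
    (hf : ∀ x, f x = x ^ q) {δ z β : ℝ} (hδ : 0 ≤ δ) (hδ' : δ < 1 / 2) (hz0 : 0 < z) (hz1 : z ≤ 1)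
    (hβ : β = z ^ (-δ) * (1 + ((Fintype.card F : ℝ) - 1) * z))
    (hsum : ∑ i ∈ Finset.univ.erase i₀, 2 * (q : ℝ)⁻¹ ^ Module.finrank F (K i) +
      Fintype.card G * β ^ 2 * (∏ i ∈ Finset.univ.erase i₀,
        (1 + (β ^ 2 / Fintype.card F) ^ Module.finrank F (K i)) - 1) < 1) :
    ∃ b : MonoidAlgebra F G, (∀ u, u * (1 + b * conj f b) = 0 → u = 0) ∧
      ∀ u, u ≠ 0 → δ * (2 * Fintype.card G) < hammingWeight (u, u * b) := by
  classical
  have : Finite (MonoidAlgebra F G) := Module.finite_of_finite F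
  have := Fintype.ofFinite (augKer F G)
  let E := Finset.univ.erase i₀
  let bad₁ : ι → Finset (augKer F G) := fun i =>
    Finset.univ.filter fun b => φ b i * φ (conj f b) i = -1
  let bad₂ : Finset ι → Finset (augKer F G) := fun S => Finset.univ.filter fun b =>
    ∃ u, (∀ i, i ≠ i₀ → (φ u i ≠ 0 ↔ i ∈ S)) ∧
      (hammingWeight (u, u * b) : ℝ) ≤ δ * (2 * Fintype.card G)
  have hH : (0 : ℝ) < Fintype.card (augKer F G) := by exact_mod_cast Fintype.card_pos
  have h1 : ((E.biUnion bad₁).card : ℝ) ≤ Fintype.card (augKer F G) *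
      ∑ i ∈ E, 2 * (q : ℝ)⁻¹ ^ Module.finrank F (K i) := by
    calc ((E.biUnion bad₁).card : ℝ) ≤ ∑ i ∈ E, ((bad₁ i).card : ℝ) := by
          exact_mod_cast Finset.card_biUnion_le
      _ ≤ ∑ i ∈ E, 2 * (q : ℝ)⁻¹ ^ Module.finrank F (K i) * Fintype.card (augKer F G) :=
          Finset.sum_le_sum fun i hi =>
            card_not_isUnit_component_le φ h₀ hq hF hf (Finset.ne_of_mem_erase hi)
      _ = _ := by rw [← Finset.sum_mul, mul_comm]
  have h2 : (((E.powerset.erase ∅).biUnion bad₂).card : ℝ) ≤ Fintype.card (augKer F G) *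
      (Fintype.card G * β ^ 2 * (∏ i ∈ E,
        (1 + (β ^ 2 / Fintype.card F) ^ Module.finrank F (K i)) - 1)) := by
    calc (((E.powerset.erase ∅).biUnion bad₂).card : ℝ)
        ≤ ∑ S ∈ E.powerset.erase ∅, ((bad₂ S).card : ℝ) := by
          exact_mod_cast Finset.card_biUnion_le
      _ ≤ ∑ S ∈ E.powerset.erase ∅, Fintype.card (augKer F G) * (Fintype.card G * β ^ 2 *
          ∏ i ∈ S, (β ^ 2 / Fintype.card F) ^ Module.finrank F (K i)) := by
          refine Finset.sum_le_sum fun S hS => ?_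
          have hS0 : i₀ ∉ S := fun h =>
            Finset.ne_of_mem_erase (Finset.mem_powerset.1 (Finset.mem_of_mem_erase hS) h) rfl
          exact card_exists_lowWeight_le φ h₀ hS0 hδ hz0 hz1 _
            (fun b hb => (Finset.mem_filter.1 hb).2) hβ
      _ = _ := by
          -- Expanding $\prod(1+x_i)$ over subsets; the subtracted $1$ is the empty one.
          rw [← Finset.mul_sum, ← Finset.mul_sum, Finset.prod_one_add,
            ← Finset.add_sum_erase _ _ (Finset.empty_mem_powerset E), Finset.prod_empty,
            add_sub_cancel_left]
  have hex : ∃ b : augKer F G, b ∉ E.biUnion bad₁ ∪ (E.powerset.erase ∅).biUnion bad₂ := by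
    by_contra! h
    have h3 : (Fintype.card (augKer F G) : ℝ) ≤
        (E.biUnion bad₁).card + ((E.powerset.erase ∅).biUnion bad₂).card := by
      have : Fintype.card (augKer F G) ≤
          (E.biUnion bad₁).card + ((E.powerset.erase ∅).biUnion bad₂).card := by
        rw [← Finset.card_univ]
        exact (Finset.card_le_card fun b _ => h b).trans (Finset.card_union_le _ _)
      exact_mod_cast this
    have h4 := mul_lt_mul_of_pos_left hsum hH
    rw [mul_add, mul_one] at h4
    linarith
  obtain ⟨⟨b, hb0⟩, hb⟩ := hex
  simp only [Finset.mem_union, Finset.mem_biUnion, not_or, not_exists, not_and] at hb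
  refine ⟨b, fun u hu => ?_, fun u hu => ?_⟩
  · apply φ.injective
    rw [map_zero]
    funext i
    have e : φ u i * (1 + φ b i * φ (conj f b) i) = 0 := by
      have := congrFun (congrArg φ hu) i
      simpa using this
    refine (mul_eq_zero.1 e).resolve_right fun h => ?_
    by_cases hi : i = i₀
    · subst hi
      rw [(h₀ b).2 hb0, zero_mul, add_zero] at h
      exact one_ne_zero h
    · refine hb.1 i (Finset.mem_erase.2 ⟨hi, Finset.mem_univ _⟩) ?_
      simp only [bad₁, Finset.mem_filter, Finset.mem_univ, true_and]
      linear_combination h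
  · by_contra! hlow
    -- If $u$ lives on the trivial component alone, it has full support, and $\delta<1/2$ excludes
    -- low weight.
    by_cases hS : ∀ i, i ≠ i₀ → φ u i = 0
    · have hc := card_support_of_mul_eq_zero hu fun g => by
        apply φ.injective
        rw [map_mul, map_zero]
        funext i
        by_cases hi : i = i₀
        · subst hi
          have : aug (MonoidAlgebra.single g (1 : F) - 1) = 0 := by simp
          rw [Pi.mul_apply, (h₀ _).2 this, mul_zero, Pi.zero_apply]
        · rw [Pi.mul_apply, hS i hi, zero_mul, Pi.zero_apply]
      have : (Fintype.card G : ℝ) ≤ hammingWeight (u, u * b) := by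
        rw [hammingWeight, hc]
        exact_mod_cast Nat.le_add_right _ _
      have : (0 : ℝ) < Fintype.card G := by exact_mod_cast Fintype.card_pos
      nlinarith
    · push Not at hS
      obtain ⟨i, hi, hui⟩ := hS
      let S := E.filter fun i => φ u i ≠ 0
      have hiS : i ∈ S := by simp [S, E, hi, hui]
      refine hb.2 S (Finset.mem_erase.2 ⟨Finset.ne_empty_of_mem hiS,
        Finset.mem_powerset.2 (Finset.filter_subset _ _)⟩) ?_
      simp only [bad₂, Finset.mem_filter, Finset.mem_univ, true_and]
      exact ⟨u, fun j hj => by simp [S, E, hj], hlow⟩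


end

-- Semisimple decomposition and the quantity $\mu$

universe u v

/-- The decomposition of a semisimple group algebra into fields. -/
lemma exists_components (F : Type u) (G : Type v) [Field F] [Fintype F] [CommGroup G] [Fintype G]
    (hG : (Fintype.card G : F) ≠ 0) :
    ∃ (ι : Type (max u v)) (_ : Fintype ι) (K : ι → Type (max u v)) (_ : ∀ i, Field (K i))
      (_ : ∀ i, Algebra F (K i)) (φ : MonoidAlgebra F G ≃ₐ[F] ∀ i, K i) (i₀ : ι),
      ∀ a, φ a i₀ = 0 ↔ aug a = 0 := by
  -- Maschke: as $|G|$ is invertible the algebra is reduced, and being finite it is the product of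
  -- its residue fields. The trivial component belongs to the augmentation ideal.
  have : NeZero (Nat.card G : F) := ⟨by rwa [Nat.card_eq_fintype_card]⟩
  have : IsReduced (MonoidAlgebra F G) := inferInstance
  have : Finite (MonoidAlgebra F G) := Module.finite_of_finite F
  have := Fintype.ofFinite (MaximalSpectrum (MonoidAlgebra F G))
  let φ := (IsArtinianRing.equivPi (MonoidAlgebra F G)).restrictScalars F
  have hm : (RingHom.ker (aug (F := F) (G := G))).IsMaximal :=
    RingHom.ker_isMaximal_of_surjective _ fun r => ⟨MonoidAlgebra.single 1 r, by simp⟩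
  refine ⟨MaximalSpectrum (MonoidAlgebra F G), inferInstance, fun m => MonoidAlgebra F G ⧸ m.asIdeal,
    fun m => Ideal.Quotient.field m.asIdeal,
    fun m => inferInstanceAs (Algebra F (MonoidAlgebra F G ⧸ m.asIdeal)), φ, ⟨_, hm⟩, fun a => ?_⟩
  exact Ideal.Quotient.eq_zero_iff_mem.trans RingHom.mem_ker

section
variable {F : Type u} {G : Type v} [Field F] [CommGroup G] [Fintype G]
  {ι : Type*} [DecidableEq ι] {K : ι → Type*} [∀ i, Field (K i)] [∀ i, Algebra F (K i)]
  (φ : MonoidAlgebra F G ≃ₐ[F] ∀ i, K i) {i₀ : ι}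
  (h₀ : ∀ a, φ a i₀ = 0 ↔ aug a = 0)

lemma aug_trivialIdempotent (hG : (Fintype.card G : F) ≠ 0) : aug (trivialIdempotent F G) = 1 := by
  rw [trivialIdempotent, map_smul, map_sum]
  simp [hG]

include h₀ in
-- An idempotent below $e$ is determined by its $i$-th component, an idempotent of a field. The
-- element $e_0$ is excluded because its augmentation is $1$.
lemma primitive_of_component (hG : (Fintype.card G : F) ≠ 0) {i : ι} (hi : i ≠ i₀)
    {e : MonoidAlgebra F G} (he : φ e = Pi.single i 1) :
    (e ≠ 0 ∧ IsIdempotentElem e ∧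
      ∀ f : MonoidAlgebra F G, IsIdempotentElem f → f * e = f → f = 0 ∨ f = e) ∧
    e ≠ trivialIdempotent F G := by
  refine ⟨⟨?_, ?_, fun f hf hfe => ?_⟩, ?_⟩
  · rintro rfl
    have := congrFun he i
    simp at this
  · apply φ.injective
    rw [map_mul, he, ← Pi.single_mul, one_mul]
  · have hf' : φ f = Pi.single i (φ f i) := by
      rw [← hfe, map_mul, he]
      funext j
      by_cases hj : j = i
      · subst hj; simp
      · simp [hj]
    have hid : φ f i * φ f i = φ f i := by
      rw [← Pi.mul_apply, ← map_mul, hf]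
    rcases mul_eq_zero.1 (show φ f i * (φ f i - 1) = 0 by rw [mul_sub, hid, mul_one, sub_self])
      with h | h
    · left
      apply φ.injective
      rw [hf', h, Pi.single_zero, map_zero]
    · right
      apply φ.injective
      rw [hf', sub_eq_zero.1 h, he]
  · rintro rfl
    have h : φ (trivialIdempotent F G) i₀ = 0 := by rw [he, Pi.single_eq_of_ne hi.symm]
    rw [h₀, aug_trivialIdempotent hG] at h
    exact one_ne_zero h

include h₀ in
-- The idempotent $e$ equal to $1$ on component $i$ and $0$ elsewhere competes in the definition of
-- `mu`, and its ideal embeds in $K_i$.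
lemma mu_le_finrank (hG : (Fintype.card G : F) ≠ 0) {i : ι} (hi : i ≠ i₀) :
    mu F G ≤ Module.finrank F (K i) := by
  have : Module.Finite F (K i) := .of_surjective
    ((LinearMap.proj i).comp φ.toLinearMap) fun w => ⟨φ.symm (Pi.single i w), by simp⟩
  set e := φ.symm (Pi.single i 1) with he
  have he' : φ e = Pi.single i 1 := by simp [he]
  obtain ⟨h1, h2⟩ := primitive_of_component φ h₀ hG hi he'
  have hle : mu F G ≤ Module.finrank F (Ideal.span {e} : Ideal (MonoidAlgebra F G)) := by
    unfold mu
    exact Nat.sInf_le ⟨e, h1, h2, rfl⟩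
  refine hle.trans ?_
  let r : (Ideal.span {e} : Ideal (MonoidAlgebra F G)) →ₗ[F] K i :=
    { toFun := fun x => φ x i
      map_add' := fun x y => by simp
      map_smul' := fun c x => congrFun (map_smul φ c (x : MonoidAlgebra F G)) i }
  refine LinearMap.finrank_le_finrank_of_injective (f := r) ?_
  rw [injective_iff_map_eq_zero]
  rintro ⟨x, hx⟩ h
  obtain ⟨a, rfl⟩ := Ideal.mem_span_singleton'.1 hx
  ext1
  apply φ.injective
  rw [ZeroMemClass.coe_zero, map_zero]
  funext j
  by_cases hj : j = i
  · subst hj; exact h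
  · simp [he', hj]

include h₀ in
lemma mu_pos (hG : (Fintype.card G : F) ≠ 0) (hcard : 1 < Fintype.card G) : 0 < mu F G := by
  obtain ⟨g, hg⟩ := Fintype.exists_ne_of_one_lt_card hcard 1
  have hne : MonoidAlgebra.single g (1 : F) - 1 ≠ 0 := by
    rw [sub_ne_zero, MonoidAlgebra.one_def, Ne, MonoidAlgebra.single_left_inj one_ne_zero]
    exact hg
  obtain ⟨i, hi⟩ : ∃ i, φ (MonoidAlgebra.single g (1 : F) - 1) i ≠ 0 := by
    by_contra! h
    exact hne (φ.injective (by rw [map_zero]; exact funext h))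
  have hi₀ : i ≠ i₀ := by
    rintro rfl
    exact hi ((h₀ _).2 (by simp))
  obtain ⟨h1, h2⟩ := primitive_of_component φ h₀ hG hi₀ (φ.apply_symm_apply (Pi.single i 1))
  -- The infimum over an empty set is $0$, so a nontrivial primitive idempotent must be exhibited;
  -- it comes from a component on which $g-1\ne0$.
  rw [Nat.pos_iff_ne_zero, mu, Ne, Nat.sInf_eq_zero]
  rintro (⟨e, ⟨he, -, -⟩, -, hd⟩ | hempty)
  · have : Nontrivial (Ideal.span {e} : Ideal (MonoidAlgebra F G)) :=
      ⟨⟨⟨e, Ideal.mem_span_singleton_self e⟩, 0, fun h => he (congrArg Subtype.val h)⟩⟩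
    have : Module.Finite F (Ideal.span {e} : Ideal (MonoidAlgebra F G)) := inferInstanceAs
      (Module.Finite F ((Ideal.span {e} : Ideal (MonoidAlgebra F G)).restrictScalars F))
    exact Module.finrank_pos.ne hd
  · exact (Set.eq_empty_iff_forall_notMem.1 hempty) _ ⟨_, h1, h2, rfl⟩

end

lemma card_cast_ne_zero {F : Type*} [Field F] [Fintype F] {q n : ℕ}
    (hF : Fintype.card F = q ^ 2) (h : Nat.Coprime n q) : (n : F) ≠ 0 := by
  intro h0
  obtain ⟨p, hp⟩ := CharP.exists F
  have hpp : p.Prime := CharP.char_is_prime F p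
  have h1 : p ∣ n := (CharP.cast_eq_zero_iff F p n).1 h0
  have h2 : p ∣ q := hpp.dvd_of_dvd_pow (n := 2)
    ((CharP.cast_eq_zero_iff F p _).1 (by rw [← hF]; exact FiniteField.cast_card_eq_zero F))
  exact Nat.not_coprime_of_dvd_of_dvd hpp.one_lt h1 h2 h

/-- Existence of a good Hermitian LCD code over one group, in terms of `μ`. -/
theorem exists_good_generator_of_mu {F : Type u} {G : Type v} [Field F] [Fintype F] [CommGroup G]
    [Fintype G] (hG : (Fintype.card G : F) ≠ 0) {q : ℕ} (hq : 2 ≤ q)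
    (hF : Fintype.card F = q ^ 2) {f : F →+* F} (hf : ∀ x, f x = x ^ q) {δ z β : ℝ}
    (hδ : 0 ≤ δ) (hδ' : δ < 1 / 2) (hz0 : 0 < z) (hz1 : z ≤ 1)
    (hβ : β = z ^ (-δ) * (1 + ((Fintype.card F : ℝ) - 1) * z))
    (hβq : β ^ 2 / Fintype.card F ≤ 1)
    (hsum : 2 * Fintype.card G * (q : ℝ)⁻¹ ^ mu F G + Fintype.card G * β ^ 2 *
      (Real.exp (Fintype.card G * (β ^ 2 / Fintype.card F) ^ mu F G) - 1) < 1) :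
    ∃ b : MonoidAlgebra F G, (∀ u, u * (1 + b * conj f b) = 0 → u = 0) ∧
      ∀ u, u ≠ 0 → δ * (2 * Fintype.card G) < hammingWeight (u, u * b) := by
  classical
  obtain ⟨ι, _, K, _, _, φ, i₀, h₀⟩ := exists_components F G hG
  have hfin : ∀ i, Module.Finite F (K i) := fun i => .of_surjective
    ((LinearMap.proj i).comp φ.toLinearMap) fun w => ⟨φ.symm (Pi.single i w), by simp⟩
  have : ∀ i, Finite (K i) := fun i => Module.finite_of_finite F
  have := fun i => Fintype.ofFinite (K i)
  set x := β ^ 2 / Fintype.card F with hx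
  have hx0 : 0 ≤ x := by positivity
  have hq1 : (q : ℝ)⁻¹ ≤ 1 := inv_le_one_of_one_le₀ (by exact_mod_cast (by omega : 1 ≤ q))
  have hcard : ((Finset.univ.erase i₀).card : ℝ) ≤ Fintype.card G := by
    -- Each component has dimension at least $1$, and the dimensions add up to $|G|$.
    have h1 : Fintype.card ι ≤ Fintype.card G := by
      rw [← finrank_monoidAlgebra (F := F) (G := G), φ.toLinearEquiv.finrank_eq,
        Module.finrank_pi_fintype, ← Finset.card_univ, Finset.card_eq_sum_ones]
      exact Finset.sum_le_sum fun i _ => Module.finrank_pos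
    exact_mod_cast (Finset.card_le_univ _).trans h1
  have hd : ∀ i ∈ Finset.univ.erase i₀, mu F G ≤ Module.finrank F (K i) := fun i hi =>
    mu_le_finrank φ h₀ hG (Finset.ne_of_mem_erase hi)
  refine exists_good_generator φ h₀ hq hF hf hδ hδ' hz0 hz1 hβ (lt_of_le_of_lt ?_ hsum)
  have h1 : ∑ i ∈ Finset.univ.erase i₀, 2 * (q : ℝ)⁻¹ ^ Module.finrank F (K i) ≤
      2 * Fintype.card G * (q : ℝ)⁻¹ ^ mu F G := by
    calc _ ≤ ∑ i ∈ Finset.univ.erase i₀, 2 * (q : ℝ)⁻¹ ^ mu F G :=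
          Finset.sum_le_sum fun i hi => mul_le_mul_of_nonneg_left
            (pow_le_pow_of_le_one (by positivity) hq1 (hd i hi)) zero_le_two
      _ = (Finset.univ.erase i₀).card * (2 * (q : ℝ)⁻¹ ^ mu F G) := by
          rw [Finset.sum_const, nsmul_eq_mul]
      _ ≤ Fintype.card G * (2 * (q : ℝ)⁻¹ ^ mu F G) := by gcongr
      _ = _ := by ring
  have h2 : ∏ i ∈ Finset.univ.erase i₀, (1 + x ^ Module.finrank F (K i)) ≤
      Real.exp (Fintype.card G * x ^ mu F G) := by
    calc _ ≤ ∏ i ∈ Finset.univ.erase i₀, Real.exp (x ^ mu F G) := by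
          refine Finset.prod_le_prod (fun i _ => by positivity) fun i hi => ?_
          have := pow_le_pow_of_le_one hx0 hβq (hd i hi)
          linarith [Real.add_one_le_exp (x ^ mu F G)]
      _ = Real.exp ((Finset.univ.erase i₀).card * x ^ mu F G) := by
          rw [Finset.prod_const, ← Real.exp_nat_mul]
      _ ≤ _ := by gcongr
  gcongr

end

end HermitianLCD

/-! ### Choice of the sequence of codes -/

theorem theorem3p17 {F : Type*} [Field F] [Fintype F] (q : ℕ) (hq : IsPrimePow q)
    (hF : Fintype.card F = q ^ 2)
    (n : ℕ → ℕ) (hodd : ∀ i, Odd (n i)) (hcop : ∀ i, Nat.Coprime (n i) q)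
    (hn : Tendsto n atTop atTop)
    (G : ℕ → Type*) [∀ i, CommGroup (G i)] [∀ i, Fintype (G i)]
    (hG : ∀ i, Fintype.card (G i) = n i)
    (hmu : Tendsto (fun i => Real.logb q (n i) / (HermitianLCD.mu F (G i) : ℝ)) atTop (𝓝 0))
    (δ : ℝ) (hδ0 : 0 ≤ δ) (hδ1 : δ ≤ 1 - (q : ℝ)⁻¹) (hδ : HermitianLCD.entropy q δ < 1 / 2) :
    ∃ C : ∀ i, HermitianLCD.TwoQuasiAbelianCode F (G i),
      (∀ i, HermitianLCD.IsHermitianLCD q (C i) ∧ HermitianLCD.rate (C i) = 1 / 2) ∧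
      (∀ᶠ i in atTop, δ < HermitianLCD.relMinDist (C i)) ∧
      HermitianLCD.IsAsymptoticallyGood C := by
  open HermitianLCD in
  have hq2 : 2 ≤ q := hq.two_le
  have hq0 : (0 : ℝ) < q := by exact_mod_cast (by omega : 0 < q)
  obtain ⟨f, hf⟩ := exists_frobenius hq hF
  obtain ⟨δ', hδδ', hδ'0, hδ'1, hδ'e⟩ := exists_pos_entropy_lt hq2 hδ0 hδ1 hδ
  obtain ⟨z, hz0, hz1, hz⟩ := exists_chernoff_parameter hq2 hδ'0 hδ'1 hδ'e
  have hhalf := lt_half_of_entropy_lt hq2 hδ'1 hδ'e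
  have hFR : (Fintype.card F : ℝ) = (q : ℝ) ^ 2 := by exact_mod_cast hF
  set β := z ^ (-δ') * (1 + ((Fintype.card F : ℝ) - 1) * z) with hβ
  rw [← hFR, ← hβ] at hz
  have hβ0 : 0 < β := by
    have : (1 : ℝ) ≤ Fintype.card F := by exact_mod_cast Fintype.card_pos
    have : 0 ≤ ((Fintype.card F : ℝ) - 1) * z := mul_nonneg (by linarith) hz0.le
    positivity
  have hx1 : β ^ 2 / Fintype.card F < 1 := by
    rw [hFR, div_lt_one (by positivity)]
    exact pow_lt_pow_left₀ hz hβ0.le two_ne_zero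
  have hx0 : 0 < β ^ 2 / Fintype.card F := by
    rw [hFR]; positivity
  have hcard : ∀ i, (Fintype.card (G i) : F) ≠ 0 := fun i => by
    rw [hG]
    exact card_cast_ne_zero hF (hcop i)
  have hpos : ∀ i, 1 < n i → 0 < mu F (G i) := fun i hi => by
    obtain ⟨ι, _, K, _, _, φ, i₀, h₀⟩ := exists_components F (G i) (hcard i)
    classical
    exact mu_pos φ h₀ (hcard i) (by rwa [hG])
  have hev := eventually_failure_lt_one hq2 hn hmu hpos hx0 hx1 (sq_nonneg β)
  have hgen : ∀ i, ∃ b : MonoidAlgebra F (G i), (∀ u, u * (1 + b * conj f b) = 0 → u = 0) ∧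
      (2 * n i * ((q : ℝ)⁻¹) ^ mu F (G i) + n i * β ^ 2 *
        (Real.exp (n i * (β ^ 2 / Fintype.card F) ^ mu F (G i)) - 1) < 1 →
        ∀ u, u ≠ 0 → δ' * (2 * Fintype.card (G i)) < hammingWeight (u, u * b)) := by
    intro i
    by_cases h : 2 * n i * ((q : ℝ)⁻¹) ^ mu F (G i) + n i * β ^ 2 *
        (Real.exp (n i * (β ^ 2 / Fintype.card F) ^ mu F (G i)) - 1) < 1
    · have h' := h
      rw [← hG] at h'
      obtain ⟨b, hb, hb'⟩ := exists_good_generator_of_mu (hcard i) hq2 hF hf hδ'0.le hhalf hz0 hz1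
        hβ hx1.le h'
      exact ⟨b, hb, fun _ => hb'⟩
    -- For the remaining indices $b=0$ still gives an LCD code, as $1+b\bar b=1$. Only finitely many
    -- such indices occur, so positivity of their distances suffices for a uniform bound.
    · exact ⟨0, fun u hu => by simpa using hu, fun h' => absurd h' h⟩
  choose b hb hbw using hgen
  have hdist : ∀ᶠ i in atTop, δ' < relMinDist (graphCode (b i)) := by
    filter_upwards [hev] with i hi
    exact lt_relMinDist_graphCode (hbw i hi)
  refine ⟨fun i => graphCode (b i), fun i => ⟨isHermitianLCD_graphCode hf (hb i),
    rate_graphCode (b i)⟩, hdist.mono fun i hi => hδδ'.trans_lt hi, ?_, ⟨1 / 4, by norm_num,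
    fun i => by rw [rate_graphCode]; norm_num⟩, ?_⟩
  · simp_rw [hG]
    exact tendsto_atTop_mono (fun i => by omega) hn
  · exact exists_pos_forall_lt (fun i => relMinDist_graphCode_pos (b i)) hδ'0 hdist
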